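/- Let $n\ge 1$ be an integer and, for $j=1,\dots,n$, let $0<r_j<\infty$, $1\le p_j<\infty$, $1\le\theta_j\le\infty$, and let $k_j>r_j$ be an integer. Put $$r=n\Big(\sum_{j=1}^n\frac1{r_j}\Big)^{-1},\qquad p=\frac nr\Big(\sum_{j=1}^n\frac1{p_jr_j}\Big)^{-1},\qquad \beta_j=\frac1{r_j}\Big(\frac rn+\frac1{p_j}-\frac1p\Big),$$ and assume that $\beta_j>0$ for all $j$. Notation, for real- or complex-valued measurable functions $f$ on $\mathbb R^n$: $f\in S_0(\mathbb R^n)$ means that $f$ is almost everywhere finite and $|\{|f|>y\}|<\infty$ for every $y>0$; $f^*(t)=\sup_{|E|=t}\inf_{x\in E}|f(x)|$ $(t>0)$ is the non-increasing rearrangement; for $0<q,s<\infty$, $\|f\|_{q,s}=\big(\int_0^\infty (t^{1/q}f^*(t))^s\,\frac{dt}t\big)^{1/s}$, and $L^{q,s}(\mathbb R^n)$ is the set of $f\in S_0(\mathbb R^n)$ with $\|f\|_{q,s}<\infty$; with $\Delta_j^{k}(h)f(x)=\sum_{i=0}^{k}(-1)^{k-i}\binom{k}{i}f(x+ihe_j)$,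 $$\|f\|_{b^{r_j}_{p_j,\theta_j;j}}=\Big(\int_0^\infty\big[h^{-r_j}\|\Delta_j^{k_j}(h)f\|_{L^{p_j}}\big]^{\theta_j}\frac{dh}h\Big)^{1/\theta_j}$$ (the essential supremum over $h>0$ of $h^{-r_j}\|\Delta_j^{k_j}(h)f\|_{L^{p_j}}$ if $\theta_j=\infty$); and $\|f\|_{L^1+L^{p_0}}=\inf\{\|g\|_{L^1}+\|h\|_{L^{p_0}}: f=g+h,\ g\in L^1,\ h\in L^{p_0}\}$. **Theorem (embedding with no limit exponent).** Let $p_0>0$ with $\frac1{p_0}>\frac1p-\frac rn$, let $\max(1,p_0)<q<\infty$ with $\frac1q>\frac1p-\frac rn$, and let $s>0$. There is a constant $c$, depending only on the parameters $n,r_j,p_j,\theta_j,k_j,p_0,q,s$, such that every locally integrable $f\in S_0(\mathbb R^n)$ with $\sum_{j=1}^n\|f\|_{b^{r_j}_{p_j,\theta_j;j}}<\infty$ and $f\in L^1(\mathbb R^n)+L^{p_0}(\mathbb R^n)$ belongs to $L^{q,s}(\mathbb R^n)$ and satisfies $$\|f\|_{q,s}\le c\Big[\|f\|_{L^1+L^{p_0}}+\prod_{j=1}^n\|f\|_{b^{r_j}_{p_j,\theta_j;j}}^{\;r/(nr_j)}\Big].$$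 -/

import Mathlib

open MeasureTheory Set
open scoped ENNReal NNReal

namespace AnisoBesov

noncomputable section

/-- The class `S₀(ℝⁿ)`: measurable functions all of whose superlevel sets
`{|f| > y}`, `y > 0`, have finite Lebesgue measure. (`ℝⁿ` is `Fin n → ℝ`; only its Lebesgue
measure and its topology matter. Finiteness of `f` is built into the codomain `𝕜 = ℝ` or `ℂ`.) -/
def MemS0 {𝕜 : Type*} [RCLike 𝕜] {n : ℕ} (f : (Fin n → ℝ) → 𝕜) : Prop :=
  AEStronglyMeasurable f volume ∧ ∀ y : ℝ, 0 < y → volume {x | y < ‖f x‖} < ∞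

/-- The non-increasing rearrangement `f^*(t) = sup_{|E| = t} inf_{x ∈ E} |f x|`, for `t > 0`. -/
def rearr {𝕜 : Type*} [RCLike 𝕜] {n : ℕ} (f : (Fin n → ℝ) → 𝕜) (t : ℝ) : ℝ≥0∞ :=
  ⨆ (E : Set (Fin n → ℝ)) (_ : MeasurableSet E) (_ : volume E = ENNReal.ofReal t),
    ⨅ x ∈ E, ‖f x‖ₑ

/-- The measure `du / u` on `(0, ∞)`. -/
def mulMeasure : Measure ℝ :=
  (volume.restrict (Ioi (0 : ℝ))).withDensity fun u => ENNReal.ofReal (1 / u)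

/-- The Lorentz functional
`‖f‖_{q,s} = (∫₀^∞ (t^{1/q} f^*(t))^s dt/t)^{1/s}`, for `0 < q, s < ∞`. -/
def lorentzNorm {𝕜 : Type*} [RCLike 𝕜] {n : ℕ} (f : (Fin n → ℝ) → 𝕜) (q s : ℝ) : ℝ≥0∞ :=
  (∫⁻ t, (ENNReal.ofReal (t ^ (1 / q)) * rearr f t) ^ s ∂mulMeasure) ^ (1 / s)

/-- Membership in the Lorentz space `L^{q,s}(ℝⁿ)`. -/
def MemLorentz {𝕜 : Type*} [RCLike 𝕜] {n : ℕ} (f : (Fin n → ℝ) → 𝕜) (q s : ℝ) : Prop :=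
  MemS0 f ∧ lorentzNorm f q s < ∞

/-- The difference of degree `k` with step `h` in the direction of the `j`-th coordinate:
`Δ_j^k(h) f (x) = ∑_{i=0}^k (-1)^{k-i} (k choose i) f (x + i h e_j)`. -/
def diffOp {𝕜 : Type*} [RCLike 𝕜] {n : ℕ} (j : Fin n) (k : ℕ) (h : ℝ)
    (f : (Fin n → ℝ) → 𝕜) (x : Fin n → ℝ) : 𝕜 :=
  ∑ i ∈ Finset.range (k + 1),
    (-1 : 𝕜) ^ (k - i) * (k.choose i : 𝕜) * f (x + ((i : ℝ) * h) • Pi.single j (1 : ℝ))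

/-- The Besov seminorm in the direction of the `j`-th coordinate, computed with differences of
degree `k`: the `L^θ((0,∞), dh/h)` norm of `h ↦ h^{-r} ‖Δ_j^k(h) f‖_p`
(an essential supremum if `θ = ∞`). -/
def besovSeminorm {𝕜 : Type*} [RCLike 𝕜] {n : ℕ} (j : Fin n) (k : ℕ) (r p : ℝ) (θ : ℝ≥0∞)
    (f : (Fin n → ℝ) → 𝕜) : ℝ≥0∞ :=
  eLpNorm (fun h : ℝ => ENNReal.ofReal (h ^ (-r)) *
    eLpNorm (diffOp j k h f) (ENNReal.ofReal p) volume) θ mulMeasure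

/-- Membership in the anisotropic Besov space
`b^{r_1,…,r_n}_{p_1,…,p_n;θ_1,…,θ_n}(ℝⁿ)`, with differences of degree `k j` in the `j`-th
coordinate. -/
def MemBesov {𝕜 : Type*} [RCLike 𝕜] {n : ℕ} (k : Fin n → ℕ) (r p : Fin n → ℝ)
    (θ : Fin n → ℝ≥0∞) (f : (Fin n → ℝ) → 𝕜) : Prop :=
  MemS0 f ∧ ∑ j, besovSeminorm j (k j) (r j) (p j) (θ j) f < ∞

/-- Membership in `L¹(ℝⁿ) + L^{p₀}(ℝⁿ)`. -/
def MemSum {𝕜 : Type*} [RCLike 𝕜] {n : ℕ} (p₀ : ℝ) (f : (Fin n → ℝ) → 𝕜) : Prop :=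
  ∃ g h : (Fin n → ℝ) → 𝕜, MemLp g 1 volume ∧ MemLp h (ENNReal.ofReal p₀) volume ∧
    f =ᵐ[volume] g + h

/-- The (quasi-)norm of `L¹(ℝⁿ) + L^{p₀}(ℝⁿ)`: the infimum of `‖g‖₁ + ‖h‖_{p₀}` over all
decompositions `f = g + h`. -/
def sumNorm {𝕜 : Type*} [RCLike 𝕜] {n : ℕ} (p₀ : ℝ) (f : (Fin n → ℝ) → 𝕜) : ℝ≥0∞ :=
  ⨅ (g : (Fin n → ℝ) → 𝕜) (h : (Fin n → ℝ) → 𝕜) (_ : MemLp g 1 volume)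
    (_ : MemLp h (ENNReal.ofReal p₀) volume) (_ : f =ᵐ[volume] g + h),
    eLpNorm g 1 volume + eLpNorm h (ENNReal.ofReal p₀) volume

/-- The mean smoothness `r = n (∑_j 1/r_j)⁻¹`. -/
def meanR {n : ℕ} (r : Fin n → ℝ) : ℝ := n * (∑ j, 1 / r j)⁻¹

/-- The mean integrability exponent `p = (n/r) (∑_j 1/(p_j r_j))⁻¹`. -/
def meanP {n : ℕ} (r p : Fin n → ℝ) : ℝ := n / meanR r * (∑ j, 1 / (p j * r j))⁻¹

/-- The numbers `β_j = (1/r_j) (r/n + 1/p_j - 1/p)`. -/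
def beta {n : ℕ} (r p : Fin n → ℝ) (j : Fin n) : ℝ :=
  1 / r j * (meanR r / n + 1 / p j - 1 / meanP r p)

end

end AnisoBesov

open AnisoBesov

/-! The proof works with the distribution function and needs no maximal functions or approximation.
For steps `h`, expanding differences direction by direction bounds `|f x|` by `D ^ n` times the sum
of two things: the largest value of `|f|` at lattice points `x + (i₁ h₁, …, iₙ hₙ)` with every `i_j
≠ 0`, and `n` times the largest difference of `f` on the lattice. Let `E` be a high superlevel set
and `F` a lower one. When every `i_j ≥ 1`, the point `x + ih` sweeps out space as `h` varies over a
set `Q`. On average over `Q`, therefore, the part of `E` moved into `F` has measure at most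
`|E||F|/|Q|`. If `|Q|` is a large multiple of `|F|`, this is a small part of `E`; on the rest some
difference is large, and Chebyshev's inequality applies.

Taking for `Q` a product of sets of good steps, on which the Besov seminorms control the differences
(`exists_good_steps`), and optimizing its side lengths gives, in terms of rearrangements, `f*(t) ≤
D^n (f*(ξ t) + c ξ^{1/R} t^{-(1/p - r/n)} P)`, where `R = ∑ 1/r_j`, `P` is the product of the
seminorms in the theorem, and `D` does not depend on `ξ` (`volume_superlevel_step`).

Let `a > 0` with `a ≥ 1/p - r/n`. With `ξ^a = 2 D^n`, iteration from `t = 1` downwards yields `f*(t)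
≲ t^{-a}` on `(0, 1]` (`volume_superlevel_iterate`). Membership in `L¹ + L^{p₀}` starts the
iteration and gives `f*(t) ≲ t^{-b}`, `b = min(1, 1/p₀)`, for `t ≥ 1`
(`volume_superlevel_le_of_sum`). The hypotheses on `q` leave room for `a < 1/q < b`, so the Lorentz
integral converges for every `s > 0`. -/

namespace AnisoBesov

/-! ### Pointwise control by lattice values and differences -/

/-- The point `x + (i₁ h₁, …, iₙ hₙ)` of the lattice with origin `x` and steps `h`. -/
def latticePoint {n : ℕ} {k : Fin n → ℕ} (x h : Fin n → ℝ) (i : ∀ j, Fin (k j + 1)) :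
    Fin n → ℝ :=
  x + fun l => ((i l : ℕ) : ℝ) * h l

lemma latticePoint_update {n : ℕ} {k : Fin n → ℕ} (x h : Fin n → ℝ) (i : ∀ j, Fin (k j + 1))
    (j : Fin n) (hj : i j = 0) (a : Fin (k j + 1)) :
    latticePoint x h i + (((a : ℕ) : ℝ) * h j) • Pi.single j (1 : ℝ) =
      latticePoint x h (Function.update i j a) := by
  ext l
  rcases eq_or_ne l j with rfl | hl
  · simp [latticePoint, hj]
  · simp [latticePoint, hl]

/-- A function value is controlled by the difference and the other values in the difference. -/
lemma norm_le_diffOp_add {𝕜 : Type*} [RCLike 𝕜] {n : ℕ} (f : (Fin n → ℝ) → 𝕜) (j : Fin n)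
    (k : ℕ) (h : ℝ) (x : Fin n → ℝ) (B : ℝ) (hB : 0 ≤ B)
    (hf : ∀ a, 1 ≤ a → a ≤ k → ‖f (x + ((a : ℝ) * h) • Pi.single j (1 : ℝ))‖ ≤ B) :
    ‖f x‖ ≤ ‖diffOp j k h f x‖ + 2 ^ k * B := by
  have hsplit : diffOp j k h f x = (∑ i ∈ Finset.range k, (-1 : 𝕜) ^ (k - (i + 1)) *
      (k.choose (i + 1) : 𝕜) * f (x + (((i + 1 : ℕ) : ℝ) * h) • Pi.single j (1 : ℝ)))
      + (-1) ^ k * f x := by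
    rw [diffOp, Finset.sum_range_succ']
    simp
  have hsum : ‖∑ i ∈ Finset.range k, (-1 : 𝕜) ^ (k - (i + 1)) *
      (k.choose (i + 1) : 𝕜) * f (x + (((i + 1 : ℕ) : ℝ) * h) • Pi.single j (1 : ℝ))‖
      ≤ 2 ^ k * B := by
    calc _ ≤ ∑ i ∈ Finset.range k, (k.choose (i + 1) : ℝ) * B := by
          refine norm_sum_le_of_le _ fun i hi => ?_
          rw [norm_mul, norm_mul, norm_pow, norm_neg, norm_one, one_pow, one_mul,
            RCLike.norm_natCast]
          exact mul_le_mul_of_nonneg_left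
            (hf _ (by omega) (by simpa using hi)) (Nat.cast_nonneg _)
      _ ≤ 2 ^ k * B := by
          rw [← Finset.sum_mul]
          refine mul_le_mul_of_nonneg_right ?_ hB
          have := Nat.sum_range_choose k
          rw [Finset.sum_range_succ'] at this
          have h2 : ∑ i ∈ Finset.range k, k.choose (i + 1) ≤ 2 ^ k := by omega
          exact_mod_cast h2
  have hx : ‖f x‖ = ‖(-1 : 𝕜) ^ k * f x‖ := by simp
  rw [hx, ← sub_eq_of_eq_add' hsplit]
  exact (norm_sub_le _ _).trans (by linarith)

/-- A value of `f` is controlled by the values at the lattice points off the coordinate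
hyperplanes and by the differences at all the lattice points. -/
lemma norm_le_of_lattice {𝕜 : Type*} [RCLike 𝕜] {n : ℕ} (f : (Fin n → ℝ) → 𝕜) (k : Fin n → ℕ)
    (x h : Fin n → ℝ) (y M D : ℝ) (hy : 0 ≤ y) (hM : 0 ≤ M) (hD : ∀ j, 2 ^ k j ≤ D) (hD1 : 1 ≤ D)
    (h0 : ∀ i : ∀ j, Fin (k j + 1), (∀ j, i j ≠ 0) → ‖f (latticePoint x h i)‖ ≤ y)
    (h1 : ∀ (j : Fin n) (i : ∀ j, Fin (k j + 1)),
      ‖diffOp j (k j) (h j) f (latticePoint x h i)‖ ≤ M) :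
    ‖f x‖ ≤ D ^ n * (y + n * M) := by
  -- Induction on the number `m` of vanishing coordinates of `i`: a difference in a direction `j`
  -- with `i j = 0` trades the point for points with `i j = 1, …, k j`, at the cost of a factor `D`
  -- and one difference.
  have key : ∀ (m : ℕ) (i : ∀ j, Fin (k j + 1)), (Finset.univ.filter fun j => i j = 0).card = m →
      ‖f (latticePoint x h i)‖ ≤ D ^ m * (y + m * M) := by
    intro m
    induction m with
    | zero =>
      intro i hi
      have hne : ∀ j, i j ≠ 0 := by
        intro j hj
        have : j ∈ Finset.univ.filter fun j => i j = 0 := by simp [hj]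
        rw [Finset.card_eq_zero.1 hi] at this
        simp at this
      simpa using h0 i hne
    | succ m ih =>
      intro i hi
      have hpos : 0 < (Finset.univ.filter fun j => i j = 0).card := by omega
      obtain ⟨j, hj⟩ := Finset.card_pos.1 hpos
      have hj0 : i j = 0 := by simpa using hj
      have hB : 0 ≤ D ^ m * (y + m * M) := by positivity
      have := norm_le_diffOp_add f j (k j) (h j) (latticePoint x h i) _ hB (by
        intro a ha1 ha2
        have hup := latticePoint_update x h i j hj0 ⟨a, by omega⟩
        rw [show (((⟨a, by omega⟩ : Fin (k j + 1)) : ℕ) : ℝ) = (a : ℝ) from rfl] at hup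
        rw [hup]
        apply ih
        have hset : (Finset.univ.filter fun l =>
            Function.update i j (⟨a, by omega⟩ : Fin (k j + 1)) l = 0)
            = (Finset.univ.filter fun l => i l = 0).erase j := by
          ext l
          rcases eq_or_ne l j with rfl | hl
          · simp only [Finset.mem_filter, Finset.mem_univ, true_and, Function.update_self,
              Finset.mem_erase, ne_eq, not_true_eq_false, false_and, iff_false]
            intro h0
            have := congrArg Fin.val h0
            simp only [Fin.val_zero] at this
            omega
          · simp [hl]
        rw [hset, Finset.card_erase_of_mem hj, hi]
        rfl)
      have h3 : 2 ^ k j * (D ^ m * (y + m * M)) ≤ D * (D ^ m * (y + m * M)) :=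
        mul_le_mul_of_nonneg_right (hD j) hB
      have h4 : M ≤ D ^ (m + 1) * M := le_mul_of_one_le_left hM (one_le_pow₀ hD1)
      calc _ ≤ M + D * (D ^ m * (y + m * M)) := this.trans (add_le_add (h1 j i) h3)
        _ ≤ D ^ (m + 1) * M + D * (D ^ m * (y + m * M)) := by linarith
        _ = _ := by push_cast; ring
  have := key n (fun _ => 0) (by simp)
  simpa [latticePoint, ← Pi.zero_def] using this

/-! ### Averaging over steps -/

/-- Averaging over the steps: some `h ∈ Q` moves few points of `E` into `F`. -/
lemma exists_step_lattice_measure_le {n : ℕ} (k : Fin n → ℕ) (E F Q : Set (Fin n → ℝ))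
    (hE : MeasurableSet E) (hF : MeasurableSet F)
    (hQ0 : volume Q ≠ 0) (hQ' : volume Q ≠ ∞)
    (I : Finset (∀ j, Fin (k j + 1))) (hI : ∀ i ∈ I, ∀ j, i j ≠ 0) :
    ∃ h ∈ Q, (∑ i ∈ I, volume (E ∩ {x | latticePoint x h i ∈ F})) * volume Q
      ≤ I.card * (volume E * volume F) := by
  have hmeas : ∀ i : ∀ j, Fin (k j + 1),
      MeasurableSet {z : (Fin n → ℝ) × (Fin n → ℝ) | latticePoint z.2 z.1 i ∈ F} := by
    intro i
    refine measurableSet_preimage (f := fun z : (Fin n → ℝ) × (Fin n → ℝ) =>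
      latticePoint z.2 z.1 i) ?_ hF
    unfold latticePoint
    fun_prop
  -- For fixed `x`, the map `h ↦ x + ih` has Jacobian `∏ i_j ≥ 1`, so preimages do not gain measure.
  -- This is where `i_j ≠ 0` is indispensable.
  have hscale : ∀ i ∈ I, ∀ x : Fin n → ℝ, volume {h | latticePoint x h i ∈ F} ≤ volume F := by
    intro i hi x
    have hone : ∀ j, (1 : ℝ) ≤ ((i j : ℕ) : ℝ) := by
      intro j
      have : (i j : ℕ) ≠ 0 := fun h => hI i hi j (Fin.ext h)
      exact_mod_cast Nat.one_le_iff_ne_zero.2 this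
    have hdet : (1 : ℝ) ≤ (Matrix.diagonal fun j => ((i j : ℕ) : ℝ)).det := by
      rw [Matrix.det_diagonal]
      calc (1 : ℝ) = ∏ _j : Fin n, (1 : ℝ) := by simp
        _ ≤ _ := Finset.prod_le_prod (fun _ _ => zero_le_one) fun j _ => hone j
    have hdet0 : (Matrix.diagonal fun j => ((i j : ℕ) : ℝ)).det ≠ 0 := by linarith
    have hlin : Measurable (Matrix.toLin' (Matrix.diagonal fun j => ((i j : ℕ) : ℝ))) :=
      (LinearMap.continuous_of_finiteDimensional _).measurable
    have hset : {h | latticePoint x h i ∈ F} =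
        Matrix.toLin' (Matrix.diagonal fun j => ((i j : ℕ) : ℝ)) ⁻¹' ((fun z => x + z) ⁻¹' F) := by
      ext h
      have : (fun l => ((i l : ℕ) : ℝ) * h l) =
          Matrix.toLin' (Matrix.diagonal fun j => ((i j : ℕ) : ℝ)) h := by
        ext l
        simp [Matrix.mulVec_diagonal]
      simp only [latticePoint, this, mem_ofPred_eq, mem_preimage]
    have hF2 : MeasurableSet ((fun z => x + z) ⁻¹' F) := measurable_const_add x hF
    calc volume {h | latticePoint x h i ∈ F}
        = Measure.map (Matrix.toLin' (Matrix.diagonal fun j => ((i j : ℕ) : ℝ))) volume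
            ((fun z => x + z) ⁻¹' F) := by rw [hset, Measure.map_apply hlin hF2]
      _ ≤ ENNReal.ofReal |(Matrix.diagonal fun j => ((i j : ℕ) : ℝ)).det| *
          Measure.map (Matrix.toLin' (Matrix.diagonal fun j => ((i j : ℕ) : ℝ))) volume
            ((fun z => x + z) ⁻¹' F) := by
          refine le_mul_of_one_le_left zero_le ?_
          rw [abs_of_nonneg (by linarith), ENNReal.one_le_ofReal]
          exact hdet
      _ = volume ((fun z => x + z) ⁻¹' F) := by
          rw [← smul_eq_mul, ← Measure.smul_apply, Real.smul_map_diagonal_volume_pi hdet0]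
      _ = volume F := measure_preimage_add _ _ _
  have hint : ∀ i ∈ I, ∫⁻ h in Q, volume (E ∩ {x | latticePoint x h i ∈ F})
      ≤ volume E * volume F := by
    intro i hi
    have hm1 : Measurable (Function.uncurry fun h x : Fin n → ℝ =>
        ({z : (Fin n → ℝ) × (Fin n → ℝ) | latticePoint z.2 z.1 i ∈ F}.indicator
          (fun _ => (1 : ℝ≥0∞)) (h, x))) :=
      (measurable_const.indicator (hmeas i))
    calc ∫⁻ h in Q, volume (E ∩ {x | latticePoint x h i ∈ F})
        = ∫⁻ h in Q, ∫⁻ x in E, {z : (Fin n → ℝ) × (Fin n → ℝ) |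
          latticePoint z.2 z.1 i ∈ F}.indicator (fun _ => (1 : ℝ≥0∞)) (h, x) := by
          refine lintegral_congr fun h => ?_
          have hs : MeasurableSet {x | latticePoint x h i ∈ F} :=
            (measurable_prodMk_left (x := h)) (hmeas i)
          have : (fun x => {z : (Fin n → ℝ) × (Fin n → ℝ) |
              latticePoint z.2 z.1 i ∈ F}.indicator (fun _ => (1 : ℝ≥0∞)) (h, x)) =
              {x | latticePoint x h i ∈ F}.indicator fun _ => (1 : ℝ≥0∞) := by
            ext x; simp [indicator]
          rw [this, lintegral_indicator_const hs, one_mul, Measure.restrict_apply hs, inter_comm]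
      _ = ∫⁻ x in E, ∫⁻ h in Q, {z : (Fin n → ℝ) × (Fin n → ℝ) |
          latticePoint z.2 z.1 i ∈ F}.indicator (fun _ => (1 : ℝ≥0∞)) (h, x) :=
          lintegral_lintegral_swap hm1.aemeasurable
      _ ≤ ∫⁻ _x in E, volume F := by
          refine lintegral_mono fun x => ?_
          have hs : MeasurableSet {h | latticePoint x h i ∈ F} :=
            (measurable_prodMk_right (y := x)) (hmeas i)
          have : (fun h => {z : (Fin n → ℝ) × (Fin n → ℝ) |
              latticePoint z.2 z.1 i ∈ F}.indicator (fun _ => (1 : ℝ≥0∞)) (h, x)) =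
              {h | latticePoint x h i ∈ F}.indicator fun _ => (1 : ℝ≥0∞) := by
            ext h; simp [indicator]
          rw [this, lintegral_indicator_const hs, one_mul]
          exact (Measure.restrict_apply_le _ _).trans (hscale i hi x)
      _ = volume E * volume F := by rw [setLIntegral_const, mul_comm]
  have hmQ : ∀ i, Measurable fun h => volume (E ∩ {x | latticePoint x h i ∈ F}) := fun i =>
    measurable_measure_prodMk_left
      ((measurable_snd hE).inter (hmeas i))
  obtain ⟨h, hh, hle⟩ := exists_le_setLAverage (μ := volume) hQ0 hQ'
    (f := fun h => ∑ i ∈ I, volume (E ∩ {x | latticePoint x h i ∈ F}))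
    (Finset.measurable_fun_sum _ fun i _ => hmQ i).aemeasurable
  refine ⟨h, hh, ?_⟩
  rw [setLAverage_eq, ENNReal.le_div_iff_mul_le (Or.inl hQ0) (Or.inl hQ')] at hle
  refine hle.trans ?_
  rw [lintegral_finsetSum _ fun i _ => hmQ i]
  calc _ ≤ ∑ i ∈ I, volume E * volume F := Finset.sum_le_sum hint
    _ = _ := by simp

/-! ### Sets of good step sizes -/

lemma measure_quarter_le_of_eLpNorm_le {α : Type*} [MeasurableSpace α] (μ : Measure α)
    (φ : α → ℝ≥0∞) (hφ : Measurable φ) (θ : ℝ≥0∞) (hθ : 1 ≤ θ) (A : ℝ≥0∞) (hA0 : A ≠ 0)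
    (hA' : A ≠ ∞) (h : eLpNorm φ θ μ ≤ A) : μ {u | 4 * A < φ u} ≤ 4⁻¹ := by
  rcases eq_or_ne θ ∞ with rfl | hθ'
  · have hae : ∀ᵐ u ∂μ, φ u ≤ A := by
      have := ae_le_eLpNormEssSup (f := φ) (μ := μ)
      filter_upwards [this] with u hu
      rw [eLpNorm_exponent_top] at h
      exact (le_trans (by simp) hu).trans h
    have : μ {u | 4 * A < φ u} = 0 := by
      refine measure_mono_null (fun u hu => ?_) (ae_iff.1 hae)
      simp only [mem_ofPred_eq, not_le] at hu ⊢
      exact lt_of_le_of_lt (le_mul_of_one_le_left zero_le (by norm_num)) hu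
    simp [this]
  · have hθ0 : θ ≠ 0 := (lt_of_lt_of_le one_pos hθ).ne'
    have h1 : 1 ≤ θ.toReal := by
      simpa using ENNReal.toReal_mono hθ' hθ
    have hm := mul_meas_ge_le_pow_eLpNorm' μ hθ0 hθ' hφ.aestronglyMeasurable (4 * A)
    have h4 : 4 * A ≠ 0 := by simp [hA0]
    have h4' : 4 * A ≠ ∞ := ENNReal.mul_ne_top (by simp) hA'
    have hle : (4 * A) ^ θ.toReal * μ {u | 4 * A < φ u} ≤ A ^ θ.toReal := by
      refine le_trans (mul_le_mul_right (measure_mono fun u hu => ?_) _)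
        (hm.trans (ENNReal.rpow_le_rpow h (by linarith)))
      simpa using (le_of_lt hu)
    rw [ENNReal.mul_rpow_of_nonneg _ _ (by linarith), mul_right_comm] at hle
    have hAt : A ^ θ.toReal ≠ 0 := by simp [hA0, hA']
    have hAt' : A ^ θ.toReal ≠ ∞ := ENNReal.rpow_ne_top_of_nonneg (by linarith) hA'
    have h5 : (4 : ℝ≥0∞) ^ θ.toReal * μ {u | 4 * A < φ u} ≤ 1 := by
      rw [← ENNReal.mul_le_mul_iff_left hAt hAt', one_mul]
      exact hle
    -- Since `θ ≥ 1`, `4 ^ θ ≥ 4`; hence the bound `1/4` is uniform in `θ`.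
    have h6 : 4 * μ {u | 4 * A < φ u} ≤ 1 := by
      refine le_trans (mul_le_mul_left ?_ _) h5
      calc (4 : ℝ≥0∞) = 4 ^ (1 : ℝ) := by simp
        _ ≤ _ := ENNReal.rpow_le_rpow_of_exponent_le (by norm_num) h1
    rw [ENNReal.le_inv_iff_mul_le, mul_comm]
    exact h6

lemma volume_le_mulMeasure {δ : ℝ} (hδ : 0 < δ) {B : Set ℝ} (hB : MeasurableSet B)
    (hBδ : B ⊆ Icc δ (2 * δ)) : volume B ≤ ENNReal.ofReal (2 * δ) * mulMeasure B := by
  rw [mulMeasure, withDensity_apply _ hB, Measure.restrict_restrict hB,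
    inter_eq_left.2 (hBδ.trans fun u hu => mem_Ioi.2 (lt_of_lt_of_le hδ hu.1)),
    ← lintegral_const_mul _ (by fun_prop)]
  calc volume B = ∫⁻ _u in B, 1 := by simp
    _ ≤ _ := by
      refine setLIntegral_mono (by fun_prop) fun u hu => ?_
      have hu0 : 0 < u := hδ.trans_le (hBδ hu).1
      rw [← ENNReal.ofReal_mul (by linarith), ENNReal.one_le_ofReal, mul_one_div,
        one_le_div hu0]
      exact (hBδ hu).2

/-- Bad steps have `dh/h`-measure at most `1/4`, and `dh ≤ 2δ dh/h` on `[δ, 2δ]`. They thus occupy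
at most `δ/2` of this interval of length `δ`, whatever the value of `θ`. -/
lemma exists_good_steps (φ : ℝ → ℝ≥0∞) (hφ : Measurable φ) (θ : ℝ≥0∞) (hθ : 1 ≤ θ) (A : ℝ≥0∞)
    (hA0 : A ≠ 0) (hA' : A ≠ ∞) (h : eLpNorm φ θ mulMeasure ≤ A) (δ : ℝ) (hδ : 0 < δ) :
    ∃ G : Set ℝ, MeasurableSet G ∧ G ⊆ Icc δ (2 * δ) ∧ ENNReal.ofReal (δ / 2) ≤ volume G ∧
      ∀ u ∈ G, φ u ≤ 4 * A := by
  have hB : MeasurableSet {u | 4 * A < φ u} := measurableSet_lt measurable_const hφ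
  refine ⟨Icc δ (2 * δ) \ {u | 4 * A < φ u}, measurableSet_Icc.diff hB, sdiff_subset, ?_,
    fun u hu => not_lt.1 hu.2⟩
  have h1 := volume_le_mulMeasure hδ (measurableSet_Icc.inter hB) (inter_subset_left)
  have h2 : volume (Icc δ (2 * δ) ∩ {u | 4 * A < φ u}) ≤ ENNReal.ofReal (δ / 2) := by
    calc _ ≤ ENNReal.ofReal (2 * δ) * 4⁻¹ := h1.trans (mul_le_mul_right
          ((measure_mono inter_subset_right).trans
            (measure_quarter_le_of_eLpNorm_le _ φ hφ θ hθ A hA0 hA' h)) _)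
      _ = ENNReal.ofReal (δ / 2) := by
          rw [show δ / 2 = 2 * δ * 4⁻¹ by ring, ENNReal.ofReal_mul (p := 2 * δ) (by linarith),
            ENNReal.ofReal_inv_of_pos (by norm_num)]
          simp
  have h3 := measure_inter_add_sdiff (μ := volume) (Icc δ (2 * δ)) hB
  rw [Real.volume_Icc, show 2 * δ - δ = δ / 2 + δ / 2 by ring,
    ENNReal.ofReal_add (by linarith) (by linarith)] at h3
  by_contra! hlt
  exact absurd h3 (ENNReal.add_lt_add_of_le_of_lt ((h2.trans_lt ENNReal.ofReal_lt_top).ne)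
    h2 hlt).ne

/-! ### Measurability of differences and Chebyshev bounds -/

lemma measurable_eLpNorm_diffOp {𝕜 : Type*} [RCLike 𝕜] {n : ℕ} (f : (Fin n → ℝ) → 𝕜)
    (hf : Measurable f) (j : Fin n) (k : ℕ) (p : ℝ) (hp : 1 ≤ p) :
    Measurable fun h => eLpNorm (diffOp j k h f) (ENNReal.ofReal p) volume := by
  have hp0 : ENNReal.ofReal p ≠ 0 := by simp; linarith
  simp only [eLpNorm_eq_lintegral_rpow_enorm_toReal hp0 ENNReal.ofReal_ne_top]
  refine Measurable.pow_const ?_ _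
  refine Measurable.lintegral_prod_right'
    (f := fun z : ℝ × (Fin n → ℝ) => ‖diffOp j k z.1 f z.2‖ₑ ^ (ENNReal.ofReal p).toReal) ?_
  refine Measurable.pow_const (Measurable.enorm ?_) _
  unfold diffOp
  refine Finset.measurable_fun_sum _ fun i _ => Measurable.const_mul (hf.comp ?_) _
  fun_prop

lemma measurable_diffOp {𝕜 : Type*} [RCLike 𝕜] {n : ℕ} (f : (Fin n → ℝ) → 𝕜)
    (hf : Measurable f) (j : Fin n) (k : ℕ) (h : ℝ) : Measurable (diffOp j k h f) := by
  unfold diffOp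
  refine Finset.measurable_fun_sum _ fun i _ => Measurable.const_mul (hf.comp ?_) _
  fun_prop

lemma diffOp_congr_ae {𝕜 : Type*} [RCLike 𝕜] {n : ℕ} {f g : (Fin n → ℝ) → 𝕜}
    (hfg : f =ᵐ[volume] g) (j : Fin n) (k : ℕ) (h : ℝ) :
    diffOp j k h f =ᵐ[volume] diffOp j k h g := by
  have : ∀ i : ℕ, ∀ᵐ x : Fin n → ℝ, f (x + ((i : ℝ) * h) • Pi.single j (1 : ℝ)) =
      g (x + ((i : ℝ) * h) • Pi.single j (1 : ℝ)) := fun i =>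
    (measurePreserving_add_right volume _).quasiMeasurePreserving.ae_eq hfg
  filter_upwards [ae_all_iff.2 this] with x hx
  simp [diffOp, hx]

lemma besovSeminorm_congr_ae {𝕜 : Type*} [RCLike 𝕜] {n : ℕ} {f g : (Fin n → ℝ) → 𝕜}
    (hfg : f =ᵐ[volume] g) (j : Fin n) (k : ℕ) (r p : ℝ) (θ : ℝ≥0∞) :
    besovSeminorm j k r p θ f = besovSeminorm j k r p θ g := by
  unfold besovSeminorm
  congr 1
  ext h
  rw [eLpNorm_congr_ae (diffOp_congr_ae hfg j k h)]

/-- Chebyshev's inequality for the distribution function. -/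
lemma volume_lt_norm_le_rpow {𝕜 : Type*} [RCLike 𝕜] {n : ℕ} (g : (Fin n → ℝ) → 𝕜) (p B M : ℝ)
    (hg : AEStronglyMeasurable g volume) (hp : 0 < p) (hB : 0 ≤ B) (hM : 0 < M)
    (h : eLpNorm g (ENNReal.ofReal p) volume ≤ ENNReal.ofReal B) :
    volume {x | M < ‖g x‖} ≤ ENNReal.ofReal ((B / M) ^ p) := by
  have hch := mul_meas_ge_le_pow_eLpNorm' volume (p := ENNReal.ofReal p) (by simpa using hp)
    ENNReal.ofReal_ne_top hg (ENNReal.ofReal M)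
  rw [ENNReal.toReal_ofReal hp.le] at hch
  have hsub : volume {x | M < ‖g x‖} ≤ volume {x | ENNReal.ofReal M ≤ ‖g x‖ₑ} := by
    refine measure_mono fun x hx => ?_
    simp only [mem_ofPred_eq] at hx ⊢
    rw [← ofReal_norm]
    exact ENNReal.ofReal_le_ofReal hx.le
  have hM0 : ENNReal.ofReal M ^ p ≠ 0 := by
    rw [ENNReal.ofReal_rpow_of_pos hM]; simp; positivity
  have hM1 : ENNReal.ofReal M ^ p ≠ ∞ := ENNReal.rpow_ne_top_of_nonneg hp.le (by simp)
  rw [← ENNReal.mul_le_mul_iff_right hM0 hM1]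
  calc _ ≤ eLpNorm g (ENNReal.ofReal p) volume ^ p := (mul_le_mul_right hsub _).trans hch
    _ ≤ ENNReal.ofReal B ^ p := ENNReal.rpow_le_rpow h hp.le
    _ = _ := by
      rw [ENNReal.ofReal_rpow_of_pos hM, ENNReal.ofReal_rpow_of_nonneg hB hp.le,
        ← ENNReal.ofReal_mul (by positivity), ← Real.mul_rpow hM.le (by positivity),
        mul_div_cancel₀ _ hM.ne']

/-- Chebyshev gives `t κ^p`, and `κ^p ≤ κ` because `p ≥ 1` and `κ ≤ 1`; one `κ` can then serve all
the exponents `p_j`. -/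
lemma volume_lt_norm_le_of_eLpNorm_le {𝕜 : Type*} [RCLike 𝕜] {n : ℕ} (g : (Fin n → ℝ) → 𝕜)
    (hg : AEStronglyMeasurable g volume) (p t M κ : ℝ) (hp : 1 ≤ p) (ht : 0 < t) (hM : 0 < M)
    (hκ : 0 < κ) (hκ1 : κ ≤ 1)
    (h : eLpNorm g (ENNReal.ofReal p) volume ≤ ENNReal.ofReal (t ^ (1 / p) * M * κ)) :
    volume {x | M < ‖g x‖} ≤ ENNReal.ofReal (t * κ) := by
  have hp0 : 0 < p := by linarith
  refine (volume_lt_norm_le_rpow g p _ M hg hp0 (by positivity) hM h).trans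
    (ENNReal.ofReal_le_ofReal ?_)
  rw [show t ^ (1 / p) * M * κ / M = t ^ (1 / p) * κ by field_simp,
    Real.mul_rpow (by positivity) hκ.le, ← Real.rpow_mul ht.le,
    one_div_mul_cancel hp0.ne', Real.rpow_one]
  have : κ ^ p ≤ κ := by simpa using Real.rpow_le_rpow_of_exponent_ge hκ hκ1 hp
  gcongr

lemma eLpNorm_diffOp_le_of_good {𝕜 : Type*} [RCLike 𝕜] {n : ℕ} (f : (Fin n → ℝ) → 𝕜) (j : Fin n)
    (k : ℕ) (r p A δ h : ℝ) (hr : 0 < r) (hA : 0 < A) (hδ : 0 < δ) (hh : h ∈ Icc δ (2 * δ))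
    (hle : ENNReal.ofReal (h ^ (-r)) * eLpNorm (diffOp j k h f) (ENNReal.ofReal p) volume
      ≤ 4 * ENNReal.ofReal A) :
    eLpNorm (diffOp j k h f) (ENNReal.ofReal p) volume ≤
      ENNReal.ofReal (4 * A * (2 * δ) ^ r) := by
  have hh0 : 0 < h := hδ.trans_le hh.1
  have h1 : ENNReal.ofReal (h ^ r) * ENNReal.ofReal (h ^ (-r)) = 1 := by
    rw [← ENNReal.ofReal_mul (by positivity), ← Real.rpow_add hh0]; simp
  calc _ = ENNReal.ofReal (h ^ r) * (ENNReal.ofReal (h ^ (-r)) *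
        eLpNorm (diffOp j k h f) (ENNReal.ofReal p) volume) := by rw [← mul_assoc, h1, one_mul]
    _ ≤ ENNReal.ofReal (h ^ r) * (4 * ENNReal.ofReal A) := mul_le_mul_right hle _
    _ = ENNReal.ofReal (4 * A * h ^ r) := by
        rw [mul_comm, ENNReal.ofReal_mul (by positivity), ENNReal.ofReal_mul (by norm_num)]
        simp
    _ ≤ _ := by
        apply ENNReal.ofReal_le_ofReal
        have := Real.rpow_le_rpow hh0.le hh.2 hr.le
        gcongr

/-! ### Self-improvement of the distribution function -/

/-- The part of `E` moved into `F` is at most `|E|/4` and the sets of large differences add up to at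
most `t/4`, so `|E| ≤ |E|/4 + t/4`. Finiteness of `|E|`, from `S₀`, allows the absorption. -/
lemma volume_superlevel_le_of_steps {𝕜 : Type*} [RCLike 𝕜] {n : ℕ} (hn : 1 ≤ n)
    (f : (Fin n → ℝ) → 𝕜) (hf : Measurable f) (hfin : ∀ z : ℝ, 0 < z → volume {x | z < ‖f x‖} < ∞)
    (k : Fin n → ℕ) (r p : Fin n → ℝ) (θ : Fin n → ℝ≥0∞) (hr : ∀ j, 0 < r j) (hp : ∀ j, 1 ≤ p j)
    (hθ : ∀ j, 1 ≤ θ j) (A : Fin n → ℝ) (hA : ∀ j, 0 < A j)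
    (hfA : ∀ j, besovSeminorm j (k j) (r j) (p j) (θ j) f ≤ ENNReal.ofReal (A j))
    (D : ℝ) (hD : ∀ j, 2 ^ k j ≤ D) (hD1 : 1 ≤ D) (N : ℕ)
    (hN : N = Fintype.card (∀ j, Fin (k j + 1)))
    (t v y M : ℝ) (ht : 0 < t) (hv : 0 < v) (hy : 0 < y) (hM : 0 < M)
    (hd : volume {x | y < ‖f x‖} ≤ ENNReal.ofReal v)
    (δ : Fin n → ℝ) (hδ : ∀ j, 0 < δ j) (hδv : 2 ^ (n + 2) * N * v ≤ ∏ j, δ j)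
    (hδM : ∀ j, 4 * A j * (2 * δ j) ^ r j ≤ t ^ (1 / p j) * M * (1 / (4 * n * N))) :
    volume {x | D ^ n * (y + n * M) < ‖f x‖} ≤ ENNReal.ofReal t := by
  have hN0 : 1 ≤ N := by rw [hN]; exact Fintype.card_pos
  have hnR : (1 : ℝ) ≤ n := by exact_mod_cast hn
  have hNR : (1 : ℝ) ≤ N := by exact_mod_cast hN0
  -- There are `n N` pairs of a direction and a lattice point; measure `tκ` for each makes `t/4` in
  -- all.
  set κ : ℝ := 1 / (4 * n * N) with hκdef
  have hκ : 0 < κ := by positivity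
  have hκ1 : κ ≤ 1 := by
    rw [hκdef, div_le_one (by positivity)]
    nlinarith
  have hgood : ∀ j, ∃ G : Set ℝ, MeasurableSet G ∧ G ⊆ Icc (δ j) (2 * δ j) ∧
      ENNReal.ofReal (δ j / 2) ≤ volume G ∧ ∀ u ∈ G, ENNReal.ofReal (u ^ (-r j)) *
        eLpNorm (diffOp j (k j) u f) (ENNReal.ofReal (p j)) volume ≤
          4 * ENNReal.ofReal (A j) := by
    intro j
    refine exists_good_steps _ ?_ (θ j) (hθ j) _ (by simpa using hA j) (by simp) (hfA j) _ (hδ j)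
    exact Measurable.mul (by fun_prop) (measurable_eLpNorm_diffOp f hf j (k j) (p j) (hp j))
  choose G hGm hGs hGv hGA using hgood
  set E := {x | D ^ n * (y + n * M) < ‖f x‖} with hE
  set F := {x | y < ‖f x‖} with hF
  have hEm : MeasurableSet E := measurableSet_lt measurable_const hf.norm
  have hFm : MeasurableSet F := measurableSet_lt measurable_const hf.norm
  have hEfin : volume E ≠ ∞ := (hfin _ (by positivity)).ne
  -- The factor `4N` leaves `|E|/4` after summing over at most `N` multi-indices; the good sets have
  -- length at least `δ j / 2`, whence `2 ^ (n + 2)` in `hδv`.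
  have hQ : ENNReal.ofReal (4 * N * v) ≤ volume (Set.univ.pi G) := by
    rw [volume_pi_pi]
    calc ENNReal.ofReal (4 * N * v) ≤ ENNReal.ofReal (∏ j, δ j / 2) := by
          apply ENNReal.ofReal_le_ofReal
          rw [Finset.prod_div_distrib, Finset.prod_const, Finset.card_univ, Fintype.card_fin,
            le_div_iff₀ (by positivity)]
          calc _ = 2 ^ (n + 2) * N * v := by ring
            _ ≤ _ := hδv
      _ = ∏ j, ENNReal.ofReal (δ j / 2) :=
          ENNReal.ofReal_prod_of_nonneg fun j _ => (half_pos (hδ j)).le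
      _ ≤ _ := Finset.prod_le_prod' fun j _ => hGv j
  have hQ0 : volume (Set.univ.pi G) ≠ 0 := by
    refine (lt_of_lt_of_le ?_ hQ).ne'
    rw [ENNReal.ofReal_pos]; positivity
  have hQtop : volume (Set.univ.pi G) ≠ ∞ := by
    rw [volume_pi_pi]
    refine ENNReal.prod_ne_top fun j _ => ne_top_of_le_ne_top ?_ (measure_mono (hGs j))
    simp
  set I : Finset (∀ j, Fin (k j + 1)) := Finset.univ.filter fun i => ∀ j, i j ≠ 0 with hIdef
  obtain ⟨h, hhQ, hhle⟩ := exists_step_lattice_measure_le k E F (Set.univ.pi G) hEm hFm hQ0 hQtop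
    I (fun i hi => by simpa [hIdef] using hi)
  have hhG : ∀ j, h j ∈ G j := fun j => hhQ j (mem_univ j)
  set X := ∑ i ∈ I, volume (E ∩ {x | latticePoint x h i ∈ F}) with hX
  have hI : I.card ≤ N := by rw [hN]; exact Finset.card_le_univ _
  have hX4 : 4 * X ≤ volume E := by
    have h1 : X * ENNReal.ofReal (4 * N * v) ≤ N * (volume E * ENNReal.ofReal v) :=
      calc _ ≤ X * volume (Set.univ.pi G) := mul_le_mul_right hQ _
        _ ≤ I.card * (volume E * volume F) := hhle
        _ ≤ _ := by gcongr
    have hw0 : ENNReal.ofReal (N * v) ≠ 0 := by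
      rw [Ne, ENNReal.ofReal_eq_zero, not_le]; positivity
    rw [← ENNReal.mul_le_mul_iff_left hw0 ENNReal.ofReal_ne_top]
    calc _ = X * ENNReal.ofReal (4 * N * v) := by
          rw [mul_assoc (4 : ℝ), ENNReal.ofReal_mul (p := 4) (by norm_num),
            ENNReal.ofReal_ofNat]
          ring
      _ ≤ _ := h1
      _ = _ := by
          rw [ENNReal.ofReal_mul (by positivity), ENNReal.ofReal_natCast]
          ring
  have hΔ : ∀ j (i : ∀ j, Fin (k j + 1)),
      volume {x | M < ‖diffOp j (k j) (h j) f (latticePoint x h i)‖} ≤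
        ENNReal.ofReal (t * κ) := by
    intro j i
    have hshift := measure_preimage_add_right (volume : Measure (Fin n → ℝ))
      (fun l => ((i l : ℕ) : ℝ) * h l) {x | M < ‖diffOp j (k j) (h j) f x‖}
    refine (le_of_eq hshift).trans ?_
    refine volume_lt_norm_le_of_eLpNorm_le _
      (measurable_diffOp f hf j (k j) (h j)).aestronglyMeasurable (p j) t M κ (hp j) ht hM hκ hκ1 ?_
    exact (eLpNorm_diffOp_le_of_good f j (k j) (r j) (p j) (A j) (δ j) (h j) (hr j) (hA j) (hδ j)
      (hGs j (hhG j)) (hGA j _ (hhG j))).trans (ENNReal.ofReal_le_ofReal (hδM j))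
  have hcover : E ⊆ (⋃ i ∈ I, E ∩ {x | latticePoint x h i ∈ F}) ∪
      ⋃ j, ⋃ i : ∀ j, Fin (k j + 1),
        {x | M < ‖diffOp j (k j) (h j) f (latticePoint x h i)‖} := by
    intro x hx
    by_contra hcon
    simp only [mem_union, mem_iUnion, mem_inter_iff, mem_ofPred_eq, not_or, not_exists,
      not_and, not_lt, hF] at hcon
    have := norm_le_of_lattice f k x h y M D hy.le hM.le hD hD1
      (fun i hi => hcon.1 i (by simpa [hIdef] using hi) hx) (fun j i => hcon.2 j i)
    exact absurd hx (not_lt.2 this)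
  have hEle : volume E ≤ X + ENNReal.ofReal (t / 4) := by
    calc volume E ≤ _ := measure_mono hcover
      _ ≤ X + ∑ j : Fin n, ∑ _i : ∀ j, Fin (k j + 1), ENNReal.ofReal (t * κ) := by
          refine (measure_union_le _ _).trans (add_le_add (measure_biUnion_finset_le _ _) ?_)
          refine (measure_iUnion_fintype_le _ _).trans (Finset.sum_le_sum fun j _ => ?_)
          exact (measure_iUnion_fintype_le _ _).trans (Finset.sum_le_sum fun i _ => hΔ j i)
      _ = _ := by
          simp only [Finset.sum_const, Finset.card_univ, ← hN, Fintype.card_fin, nsmul_eq_mul]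
          rw [← ENNReal.ofReal_natCast, ← ENNReal.ofReal_natCast,
            ← ENNReal.ofReal_mul (by positivity), ← ENNReal.ofReal_mul (by positivity), hκdef]
          congr 2
          field_simp
  have hXfin : X ≠ ∞ := ne_top_of_le_ne_top hEfin
    ((le_mul_of_one_le_left zero_le (by norm_num)).trans hX4)
  rw [← ENNReal.ofReal_toReal hEfin]
  apply ENNReal.ofReal_le_ofReal
  have e1 := ENNReal.toReal_mono hEfin hX4
  have e2 := ENNReal.toReal_mono (by simp [hXfin]) hEle
  rw [ENNReal.toReal_add hXfin (by simp), ENNReal.toReal_ofReal (by positivity)] at e2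
  rw [ENNReal.toReal_mul, ENNReal.toReal_ofNat] at e1
  have : 0 ≤ X.toReal := ENNReal.toReal_nonneg
  linarith

/-- Self-improvement of the distribution function, with a factor `D ^ n` independent of `ξ`. The
steps `δ j` equalize the contributions of the coordinate directions. -/
lemma volume_superlevel_step {𝕜 : Type*} [RCLike 𝕜] {n : ℕ} (hn : 1 ≤ n)
    (f : (Fin n → ℝ) → 𝕜) (hf : Measurable f) (hfin : ∀ z : ℝ, 0 < z → volume {x | z < ‖f x‖} < ∞)
    (k : Fin n → ℕ) (r p : Fin n → ℝ) (θ : Fin n → ℝ≥0∞) (hr : ∀ j, 0 < r j) (hp : ∀ j, 1 ≤ p j)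
    (hθ : ∀ j, 1 ≤ θ j) (A : Fin n → ℝ) (hA : ∀ j, 0 < A j)
    (hfA : ∀ j, besovSeminorm j (k j) (r j) (p j) (θ j) f ≤ ENNReal.ofReal (A j))
    (D : ℝ) (hD : ∀ j, 2 ^ k j ≤ D) (hD1 : 1 ≤ D) (N : ℕ)
    (hN : N = Fintype.card (∀ j, Fin (k j + 1)))
    (R S : ℝ) (hR : R = ∑ j, 1 / r j) (hS : S = ∑ j, 1 / (p j * r j))
    (ξ t y : ℝ) (hξ : 0 < ξ) (ht : 0 < t) (hy : 0 < y)
    (hd : volume {x | y < ‖f x‖} ≤ ENNReal.ofReal (ξ * t)) :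
    volume {x | D ^ n * (y + n * (16 * n * N * 2 ^ (∑ j, r j) *
      ((2 ^ (n + 2) * N * ξ) ^ (1 / R) * t ^ ((1 - S) / R) * ∏ j, A j ^ (1 / (R * r j))))) < ‖f x‖}
      ≤ ENNReal.ofReal t := by
  have hN0 : 1 ≤ N := by rw [hN]; exact Fintype.card_pos
  have hnR : (1 : ℝ) ≤ n := by exact_mod_cast hn
  have hNR : (1 : ℝ) ≤ N := by exact_mod_cast hN0
  have hR0 : 0 < R := by
    rw [hR]
    exact Finset.sum_pos (fun j _ => one_div_pos.2 (hr j)) ⟨⟨0, hn⟩, Finset.mem_univ _⟩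
  have hP : 0 < ∏ j, A j ^ (1 / (R * r j)) :=
    Finset.prod_pos fun j _ => Real.rpow_pos_of_pos (hA j) _
  -- With `δ_j ^ r_j = μ t^{1/p_j} / A_j`, every direction asks for the same `M` up to the factor `2
  -- ^ r_j`. The value of `μ` is the solution of `∏ δ_j = 2^{n+2} N ξ t`.
  set μ := (2 ^ (n + 2) * N * ξ) ^ (1 / R) * t ^ ((1 - S) / R) * ∏ j, A j ^ (1 / (R * r j))
    with hμdef
  have hμ : 0 < μ := by positivity
  have hδr : ∀ j, ((μ * t ^ (1 / p j) / A j) ^ (1 / r j)) ^ r j = μ * t ^ (1 / p j) / A j := by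
    intro j
    have := hA j
    rw [← Real.rpow_mul (by positivity), one_div_mul_cancel (hr j).ne', Real.rpow_one]
  refine volume_superlevel_le_of_steps hn f hf hfin k r p θ hr hp hθ A hA hfA D hD hD1 N hN
    t (ξ * t) y _ ht (by positivity) hy (by positivity) hd
    (fun j => (μ * t ^ (1 / p j) / A j) ^ (1 / r j)) (fun j => ?_) ?_ fun j => ?_
  · have := hA j
    positivity
  · have hfac : ∀ j, (μ * t ^ (1 / p j) / A j) ^ (1 / r j) =
        μ ^ (1 / r j) * t ^ (1 / (p j * r j)) * (A j ^ (1 / (R * r j)))⁻¹ ^ R := by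
      intro j
      have hAj := hA j
      have hrj := (hr j).ne'
      rw [Real.div_rpow (by positivity) hAj.le, Real.mul_rpow hμ.le (by positivity),
        ← Real.rpow_mul ht.le, div_eq_mul_inv, Real.inv_rpow (by positivity),
        ← Real.rpow_mul hAj.le]
      congr 3
      · rw [one_div_mul_one_div]
      · field_simp
    have hprod : ∏ j, (μ * t ^ (1 / p j) / A j) ^ (1 / r j) =
        μ ^ R * t ^ S * ((∏ j, A j ^ (1 / (R * r j))) ^ R)⁻¹ := by
      simp_rw [hfac]
      rw [Finset.prod_mul_distrib, Finset.prod_mul_distrib, ← Real.rpow_sum_of_pos hμ,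
        ← Real.rpow_sum_of_pos ht, ← hR, ← hS,
        Real.finsetProd_rpow _ _ fun j _ => inv_nonneg.2 (Real.rpow_nonneg (hA j).le _),
        Finset.prod_inv_distrib, Real.inv_rpow hP.le]
    rw [hprod, hμdef, Real.mul_rpow (by positivity) hP.le,
      Real.mul_rpow (by positivity) (by positivity), ← Real.rpow_mul (by positivity),
      ← Real.rpow_mul ht.le, one_div_mul_cancel hR0.ne', div_mul_cancel₀ _ hR0.ne', Real.rpow_one]
    have e : t ^ (1 - S) * t ^ S = t := by rw [← Real.rpow_add ht]; simp
    have hPR := (Real.rpow_pos_of_pos hP R).ne'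
    refine le_of_eq ?_
    calc 2 ^ (n + 2) * (N : ℝ) * (ξ * t)
        = 2 ^ (n + 2) * N * ξ * (t ^ (1 - S) * t ^ S) := by rw [e]; ring
      _ = _ := by field_simp
  · have hAj := hA j
    rw [Real.mul_rpow (by norm_num) (by positivity), hδr]
    have h2 : (2 : ℝ) ^ r j ≤ 2 ^ ∑ j, r j :=
      Real.rpow_le_rpow_of_exponent_le (by norm_num)
        (Finset.single_le_sum (fun i _ => (hr i).le) (Finset.mem_univ j))
    calc 4 * A j * (2 ^ r j * (μ * t ^ (1 / p j) / A j))
        = 4 * 2 ^ r j * (μ * t ^ (1 / p j)) := by field_simp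
      _ ≤ 4 * 2 ^ (∑ j, r j) * (μ * t ^ (1 / p j)) := by gcongr
      _ = _ := by field_simp; ring

/-- Each passage from `ξ^{-m}` to `ξ^{-(m+1)}` raises the level by the factor `ξ ^ a`. As `2 D ^ n ≤
ξ ^ a`, the old level uses at most half of the new one; by the size of `Y`, the differences use at
most the other half. -/
lemma volume_superlevel_iterate {𝕜 : Type*} [RCLike 𝕜] {n : ℕ} (hn : 1 ≤ n)
    (f : (Fin n → ℝ) → 𝕜) (hf : Measurable f) (hfin : ∀ z : ℝ, 0 < z → volume {x | z < ‖f x‖} < ∞)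
    (k : Fin n → ℕ) (r p : Fin n → ℝ) (θ : Fin n → ℝ≥0∞) (hr : ∀ j, 0 < r j) (hp : ∀ j, 1 ≤ p j)
    (hθ : ∀ j, 1 ≤ θ j) (A : Fin n → ℝ) (hA : ∀ j, 0 < A j)
    (hfA : ∀ j, besovSeminorm j (k j) (r j) (p j) (θ j) f ≤ ENNReal.ofReal (A j))
    (D : ℝ) (hD : ∀ j, 2 ^ k j ≤ D) (hD1 : 1 ≤ D) (N : ℕ)
    (hN : N = Fintype.card (∀ j, Fin (k j + 1)))
    (R S : ℝ) (hR : R = ∑ j, 1 / r j) (hS : S = ∑ j, 1 / (p j * r j))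
    (ξ a Y : ℝ) (hξ : 1 ≤ ξ) (ha : (S - 1) / R ≤ a) (hξa : 2 * D ^ n ≤ ξ ^ a) (hY : 0 < Y)
    (hYP : 2 * D ^ n * (n * (16 * n * N * 2 ^ (∑ j, r j) *
      ((2 ^ (n + 2) * N * ξ) ^ (1 / R) * ∏ j, A j ^ (1 / (R * r j))))) ≤ Y)
    (hd : volume {x | Y < ‖f x‖} ≤ 1) (m : ℕ) :
    volume {x | Y * (ξ ^ a) ^ m < ‖f x‖} ≤ ENNReal.ofReal (ξ ^ m)⁻¹ := by
  have hξ0 : 0 < ξ := by linarith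
  induction m with
  | zero => simpa using hd
  | succ m ih =>
    have hstep := volume_superlevel_step hn f hf hfin k r p θ hr hp hθ A hA hfA D hD hD1 N hN R S
      hR hS ξ (ξ ^ (m + 1))⁻¹ (Y * (ξ ^ a) ^ m) hξ0 (by positivity) (by positivity) (by
        refine ih.trans (ENNReal.ofReal_le_ofReal (le_of_eq ?_))
        field_simp
        ring)
    refine (measure_mono fun x hx => ?_).trans hstep
    simp only [mem_ofPred_eq] at hx ⊢
    refine lt_of_le_of_lt ?_ hx
    -- The difference term grows like `ξ^{(m+1)(S-1)/R}`, which is dominated since `ξ ≥ 1` and `(S -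
    -- 1)/R ≤ a`.
    have hT : ((ξ ^ (m + 1))⁻¹) ^ ((1 - S) / R) ≤ (ξ ^ a) ^ (m + 1) := by
      rw [← Real.rpow_natCast, ← Real.rpow_neg hξ0.le, ← Real.rpow_mul hξ0.le,
        ← Real.rpow_natCast (ξ ^ a), ← Real.rpow_mul hξ0.le]
      apply Real.rpow_le_rpow_of_exponent_le hξ
      have : (-((m + 1 : ℕ) : ℝ)) * ((1 - S) / R) = ((S - 1) / R) * ((m + 1 : ℕ) : ℝ) := by ring
      rw [this]
      gcongr
    have hP : 0 < ∏ j, A j ^ (1 / (R * r j)) :=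
      Finset.prod_pos fun j _ => Real.rpow_pos_of_pos (hA j) _
    set P := ∏ j, A j ^ (1 / (R * r j))
    set c := (2 ^ (n + 2) * (N : ℝ) * ξ) ^ (1 / R)
    set W := 16 * (n : ℝ) * N * 2 ^ (∑ j, r j)
    have hc : 0 ≤ c := by positivity
    have hW : 0 ≤ W := by positivity
    have hD0 : 0 ≤ D := by linarith
    have hξa0 : 0 < ξ ^ a := by positivity
    calc D ^ n * (Y * (ξ ^ a) ^ m + n * (W * (c * ((ξ ^ (m + 1))⁻¹) ^ ((1 - S) / R) * P)))
        ≤ D ^ n * (Y * (ξ ^ a) ^ m + n * (W * (c * (ξ ^ a) ^ (m + 1) * P))) := by gcongr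
      _ = 2 * D ^ n * (Y * (ξ ^ a) ^ m) / 2 +
          2 * D ^ n * (n * (W * (c * P))) * (ξ ^ a) ^ (m + 1) / 2 := by ring
      _ ≤ ξ ^ a * (Y * (ξ ^ a) ^ m) / 2 + Y * (ξ ^ a) ^ (m + 1) / 2 := by gcongr
      _ = Y * (ξ ^ a) ^ (m + 1) := by ring

/-! ### Rearrangements, decay at infinity and Lorentz functionals -/

/-- A competitor `E` with infimum above `y` lies inside the superlevel set. Since `|E| = t` exactly,
the volume bound has to be strict. -/
lemma rearr_le_of_volume_lt {𝕜 : Type*} [RCLike 𝕜] {n : ℕ} (f : (Fin n → ℝ) → 𝕜) (t y : ℝ)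
    (hy : 0 ≤ y) (h : volume {x | y < ‖f x‖} < ENNReal.ofReal t) :
    rearr f t ≤ ENNReal.ofReal y := by
  refine iSup_le fun E => iSup_le fun _ => iSup_le fun hEt => ?_
  by_contra! hlt
  refine absurd h (not_lt.2 ?_)
  rw [← hEt]
  refine measure_mono fun x hx => ?_
  have h1 := hlt.trans_le (iInf₂_le x hx)
  rw [← ofReal_norm] at h1
  exact (ENNReal.ofReal_lt_ofReal_iff_of_nonneg hy).1 h1

/-- Decay of the distribution function of an element of `L¹ + L^{p₀}`. -/
lemma volume_superlevel_le_of_sum {𝕜 : Type*} [RCLike 𝕜] {n : ℕ} (f g h : (Fin n → ℝ) → 𝕜)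
    (p₀ : ℝ) (hp₀ : 0 < p₀) (hg : MemLp g 1 volume) (hh : MemLp h (ENNReal.ofReal p₀) volume)
    (hfgh : f =ᵐ[volume] g + h) (B : ℝ) (hB : 0 < B)
    (hle : eLpNorm g 1 volume + eLpNorm h (ENNReal.ofReal p₀) volume ≤ ENNReal.ofReal B)
    (b : ℝ) (hb1 : b ≤ 1) (hb0 : b ≤ 1 / p₀) (t : ℝ) (ht : 1 ≤ t) :
    volume {x | (8 + 2 * 4 ^ (1 / p₀)) * B * t ^ (-b) < ‖f x‖} ≤ ENNReal.ofReal (t / 2) := by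
  have ht0 : 0 < t := by linarith
  have hge : eLpNorm g (ENNReal.ofReal 1) volume ≤ ENNReal.ofReal B := by
    rw [ENNReal.ofReal_one]; exact le_self_add.trans hle
  have hhe : eLpNorm h (ENNReal.ofReal p₀) volume ≤ ENNReal.ofReal B := le_add_self.trans hle
  -- The level is split evenly between `g` and `h`; the two summands of `C` bring each Chebyshev
  -- bound down to `t/4`.
  set C : ℝ := 8 + 2 * 4 ^ (1 / p₀) with hC
  have h4 : (0 : ℝ) < 4 ^ (1 / p₀) := by positivity
  set M := C * B * t ^ (-b) / 2 with hM
  have hM0 : 0 < M := by positivity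
  have hsub : volume {x | C * B * t ^ (-b) < ‖f x‖} ≤
      volume {x | M < ‖g x‖} + volume {x | M < ‖h x‖} := by
    refine le_trans (measure_mono_ae ?_) (measure_union_le _ _)
    filter_upwards [hfgh] with x hx hx1
    change C * B * t ^ (-b) < ‖f x‖ at hx1
    by_contra hcon
    have hcon1 : ¬ (M < ‖g x‖ ∨ M < ‖h x‖) := hcon
    rw [not_or, not_lt, not_lt] at hcon1
    rw [hx, Pi.add_apply] at hx1
    have := norm_add_le (g x) (h x)
    linarith [hcon1.1, hcon1.2]
  have hBM : B / M = 2 / C * t ^ b := by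
    rw [hM, Real.rpow_neg ht0.le]
    field_simp
  have h1 := volume_lt_norm_le_rpow g 1 B M hg.1 one_pos hB.le hM0 hge
  have h2 := volume_lt_norm_le_rpow h p₀ B M hh.1 hp₀ hB.le hM0 hhe
  have e1 : (B / M) ^ (1 : ℝ) ≤ t / 4 := by
    rw [Real.rpow_one, hBM]
    have i1 : t ^ b ≤ t := by
      simpa using Real.rpow_le_rpow_of_exponent_le ht hb1
    have i2 : 2 / C ≤ 1 / 4 := by
      rw [div_le_div_iff₀ (by positivity) (by norm_num)]; linarith
    calc 2 / C * t ^ b ≤ 1 / 4 * t := by gcongr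
      _ = _ := by ring
  have e2 : (B / M) ^ p₀ ≤ t / 4 := by
    rw [hBM]
    have i1 : t ^ b ≤ t ^ (1 / p₀) := Real.rpow_le_rpow_of_exponent_le ht hb0
    have i2 : 2 / C ≤ (4 ^ (1 / p₀))⁻¹ := by
      rw [← one_div, div_le_div_iff₀ (by positivity) h4]; linarith
    calc (2 / C * t ^ b) ^ p₀ ≤ ((4 ^ (1 / p₀))⁻¹ * t ^ (1 / p₀)) ^ p₀ := by gcongr
      _ = t / 4 := by
        rw [Real.mul_rpow (by positivity) (by positivity), Real.inv_rpow h4.le,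
          ← Real.rpow_mul (by norm_num), ← Real.rpow_mul ht0.le, one_div_mul_cancel hp₀.ne',
          Real.rpow_one, Real.rpow_one]
        ring
  calc _ ≤ ENNReal.ofReal (t / 4) + ENNReal.ofReal (t / 4) :=
        hsub.trans (add_le_add (h1.trans (ENNReal.ofReal_le_ofReal e1))
          (h2.trans (ENNReal.ofReal_le_ofReal e2)))
    _ = _ := by rw [← ENNReal.ofReal_add (by positivity) (by positivity)]; congr 1; ring

/-- The majorant `t^{-a}` on `(0, 1]`, `t^{-b}` on `(1, ∞)`. -/
noncomputable def powerMajorant (a b t : ℝ) : ℝ := if t ≤ 1 then t ^ (-a) else t ^ (-b)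

/-- The integrand is `t^{(u-a)s-1}` near `0` and `t^{(u-b)s-1}` at infinity; `a < u < b` puts these
exponents above and below `-1` respectively. -/
lemma lintegral_powerMajorant_lt_top (a b u s : ℝ) (ha : a < u) (hb : u < b) (hs : 0 < s) :
    ∫⁻ t, (ENNReal.ofReal (t ^ u) * ENNReal.ofReal (powerMajorant a b t)) ^ s ∂mulMeasure < ∞ := by
  have hm : Measurable fun t : ℝ =>
      (ENNReal.ofReal (t ^ u) * ENNReal.ofReal (powerMajorant a b t)) ^ s := by
    have : Measurable (powerMajorant a b) := by
      unfold powerMajorant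
      exact Measurable.ite measurableSet_Iic (by fun_prop) (by fun_prop)
    fun_prop
  have hcalc : ∀ t : ℝ, 0 < t → ∀ e : ℝ, ENNReal.ofReal (1 / t) *
      (ENNReal.ofReal (t ^ u) * ENNReal.ofReal (t ^ (-e))) ^ s =
        ENNReal.ofReal (t ^ ((u - e) * s - 1)) := by
    intro t ht e
    rw [← ENNReal.ofReal_mul (by positivity), ENNReal.ofReal_rpow_of_pos (by positivity),
      ← ENNReal.ofReal_mul (by positivity), ← Real.rpow_add ht, ← Real.rpow_mul ht.le,
      Real.rpow_sub ht, Real.rpow_one, ← sub_eq_add_neg]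
    congr 1
    ring
  rw [mulMeasure, lintegral_withDensity_eq_lintegral_mul _ (by fun_prop) hm,
    ← Ioc_union_Ioi_eq_Ioi (zero_le_one (α := ℝ))]
  refine (lintegral_union_le _ _ _).trans_lt (ENNReal.add_lt_top.2 ⟨?_, ?_⟩)
  · rw [setLIntegral_congr_fun (g := fun t => ENNReal.ofReal (t ^ ((u - a) * s - 1)))
      measurableSet_Ioc fun t ht => by
        simp only [Pi.mul_apply, powerMajorant, if_pos ht.2]
        exact hcalc t ht.1 a]
    have hpos : 0 < (u - a) * s := mul_pos (by linarith) hs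
    have := (intervalIntegral.intervalIntegrable_rpow' (a := 0) (b := 1)
      (r := (u - a) * s - 1) (by linarith))
    rw [intervalIntegrable_iff_integrableOn_Ioc_of_le zero_le_one] at this
    exact this.lintegral_lt_top
  · rw [setLIntegral_congr_fun (g := fun t => ENNReal.ofReal (t ^ ((u - b) * s - 1)))
      measurableSet_Ioi fun t ht => by
        simp only [Pi.mul_apply, powerMajorant, if_neg (not_le.2 (mem_Ioi.1 ht))]
        exact hcalc t (zero_lt_one.trans (mem_Ioi.1 ht)) b]
    have hneg : (u - b) * s < 0 := mul_neg_of_neg_of_pos (by linarith) hs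
    exact (integrableOn_Ioi_rpow_of_lt (by linarith) one_pos).lintegral_lt_top

lemma lorentzNorm_le_of_rearr_le {𝕜 : Type*} [RCLike 𝕜] {n : ℕ} (f : (Fin n → ℝ) → 𝕜)
    (q s a b K : ℝ) (hs : 0 < s) (hK : 0 ≤ K)
    (h : ∀ t, 0 < t → rearr f t ≤ ENNReal.ofReal (K * powerMajorant a b t)) :
    lorentzNorm f q s ≤ ENNReal.ofReal K * (∫⁻ t, (ENNReal.ofReal (t ^ (1 / q)) *
      ENNReal.ofReal (powerMajorant a b t)) ^ s ∂mulMeasure) ^ (1 / s) := by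
  have hae : ∀ᵐ t ∂mulMeasure, 0 < t :=
    (withDensity_absolutelyContinuous _ _).ae_le (ae_restrict_mem measurableSet_Ioi)
  have hint : ∫⁻ t, (ENNReal.ofReal (t ^ (1 / q)) * rearr f t) ^ s ∂mulMeasure ≤
      ENNReal.ofReal K ^ s * ∫⁻ t, (ENNReal.ofReal (t ^ (1 / q)) *
      ENNReal.ofReal (powerMajorant a b t)) ^ s ∂mulMeasure := by
    rw [← lintegral_const_mul' _ _ (ENNReal.rpow_ne_top_of_nonneg hs.le ENNReal.ofReal_ne_top)]
    refine lintegral_mono_ae ?_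
    filter_upwards [hae] with t ht
    rw [← ENNReal.mul_rpow_of_nonneg _ _ hs.le]
    refine ENNReal.rpow_le_rpow ?_ hs.le
    calc _ ≤ ENNReal.ofReal (t ^ (1 / q)) * ENNReal.ofReal (K * powerMajorant a b t) :=
          mul_le_mul_right (h t ht) _
      _ = _ := by rw [ENNReal.ofReal_mul hK]; ring
  calc lorentzNorm f q s ≤ _ := ENNReal.rpow_le_rpow hint (by positivity)
    _ = _ := by
      rw [ENNReal.mul_rpow_of_nonneg _ _ (by positivity), ← ENNReal.rpow_mul,
        mul_one_div_cancel hs.ne', ENNReal.rpow_one]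

/-! ### Assembly of the estimate -/

/-- The rearrangement estimate for strictly positive bounds `A j` of the seminorms. -/
lemma exists_rearr_le {𝕜 : Type*} [RCLike 𝕜] {n : ℕ} (hn : 1 ≤ n)
    (k : Fin n → ℕ) (r p : Fin n → ℝ) (θ : Fin n → ℝ≥0∞) (hr : ∀ j, 0 < r j) (hp : ∀ j, 1 ≤ p j)
    (hθ : ∀ j, 1 ≤ θ j) (R S : ℝ) (hR : R = ∑ j, 1 / r j) (hS : S = ∑ j, 1 / (p j * r j))
    (p₀ : ℝ) (hp₀ : 0 < p₀) (a b : ℝ) (ha0 : 0 < a) (ha : (S - 1) / R ≤ a) (hb1 : b ≤ 1)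
    (hb0 : b ≤ 1 / p₀) :
    ∃ C : ℝ, 0 ≤ C ∧ ∀ (f g h : (Fin n → ℝ) → 𝕜) (A : Fin n → ℝ) (B : ℝ), MemS0 f →
      (∀ j, 0 < A j) →
      (∀ j, besovSeminorm j (k j) (r j) (p j) (θ j) f ≤ ENNReal.ofReal (A j)) →
      MemLp g 1 volume → MemLp h (ENNReal.ofReal p₀) volume → f =ᵐ[volume] g + h → 0 < B →
      eLpNorm g 1 volume + eLpNorm h (ENNReal.ofReal p₀) volume ≤ ENNReal.ofReal B →
      ∀ t, 0 < t → rearr f t ≤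
        ENNReal.ofReal (C * (B + ∏ j, A j ^ (1 / (R * r j))) * powerMajorant a b t) := by
  set D : ℝ := 2 + ∑ j, 2 ^ k j with hDdef
  have hsum : (0 : ℝ) ≤ ∑ j, 2 ^ k j := Finset.sum_nonneg fun _ _ => by positivity
  have hD2 : 2 ≤ D := by linarith
  have hD : ∀ j, 2 ^ k j ≤ D := fun j => by
    have : (2 : ℝ) ^ k j ≤ ∑ j, 2 ^ k j :=
      Finset.single_le_sum (f := fun j => (2 : ℝ) ^ k j) (fun _ _ => by positivity)
        (Finset.mem_univ j)
    linarith
  set N := Fintype.card (∀ j, Fin (k j + 1)) with hN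
  set ξ : ℝ := (2 * D ^ n) ^ (1 / a) with hξdef
  have hDn : 1 ≤ D ^ n := one_le_pow₀ (by linarith)
  have hξ1 : 1 < ξ := Real.one_lt_rpow (by linarith) (by positivity)
  have hξ0 : 0 < ξ := by linarith
  have hξa : ξ ^ a = 2 * D ^ n := by
    rw [hξdef, ← Real.rpow_mul (by positivity), one_div_mul_cancel ha0.ne', Real.rpow_one]
  set C₀ : ℝ := 8 + 2 * 4 ^ (1 / p₀)
  set C₁ : ℝ := 2 * D ^ n * (n * (16 * n * N * 2 ^ (∑ j, r j) * (2 ^ (n + 2) * N * ξ) ^ (1 / R)))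
    with hC₁def
  have hC₀ : 0 < C₀ := by positivity
  have hC₁ : 0 ≤ C₁ := by positivity
  have hξa1 : 1 ≤ ξ ^ a := by rw [hξa]; linarith
  refine ⟨(C₀ + C₁) * ξ ^ a, by positivity, ?_⟩
  intro f g h A B hf hA hfA hg hh hfgh hB hle t ht
  have hP : 0 < ∏ j, A j ^ (1 / (R * r j)) :=
    Finset.prod_pos fun j _ => Real.rpow_pos_of_pos (hA j) _
  set P := ∏ j, A j ^ (1 / (R * r j)) with hPdef
  have hlarge := volume_superlevel_le_of_sum f g h p₀ hp₀ hg hh hfgh B hB hle b hb1 hb0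
  unfold powerMajorant
  split_ifs with ht1
  -- The iteration needs a measurable function; a measurable representative has the same superlevel
  -- measures and Besov seminorms.
  · have hff : f =ᵐ[volume] hf.1.mk f := hf.1.ae_eq_mk
    have hvol : ∀ y : ℝ, volume {x | y < ‖f x‖} = volume {x | y < ‖hf.1.mk f x‖} := by
      intro y
      refine measure_congr ?_
      filter_upwards [hff] with x hx
      change (y < ‖f x‖) = (y < ‖hf.1.mk f x‖)
      rw [hx]
    set Y := (C₀ + C₁) * (B + P) with hYdef
    have hYB : C₀ * B ≤ Y := by
      rw [hYdef]
      nlinarith [mul_nonneg hC₁ hB.le, mul_nonneg hC₁ hP.le, mul_nonneg hC₀.le hP.le]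
    have hYP : C₁ * P ≤ Y := by
      rw [hYdef]
      nlinarith [mul_nonneg hC₁ hB.le, mul_nonneg hC₀.le hB.le, mul_nonneg hC₀.le hP.le]
    have hY : 0 < Y := by positivity
    have hd : volume {x | Y < ‖hf.1.mk f x‖} ≤ 1 := by
      rw [← hvol]
      calc volume {x | Y < ‖f x‖} ≤ _ := measure_mono fun x hx => by
            change C₀ * B * 1 ^ (-b) < ‖f x‖
            rw [Real.one_rpow, mul_one]
            exact hYB.trans_lt hx
        _ ≤ ENNReal.ofReal (1 / 2) := hlarge 1 le_rfl
        _ ≤ 1 := by rw [ENNReal.ofReal_le_one]; norm_num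
    have hit := volume_superlevel_iterate hn (hf.1.mk f) hf.1.stronglyMeasurable_mk.measurable
      (fun z hz => by rw [← hvol]; exact hf.2 z hz) k r p θ hr hp hθ A hA
      (fun j => by rw [← besovSeminorm_congr_ae hff]; exact hfA j) D hD (by linarith) N hN R S hR hS
      ξ a Y hξ1.le ha hξa.ge hY
      (by
        rw [← hPdef]
        refine le_trans (le_of_eq ?_) hYP
        rw [hC₁def]
        ring) hd
    -- Here `ξ^m ≤ 1/t < ξ^{m+1}`. Stopping at `m + 1` makes the volume bound strict and costs the
    -- factor `ξ ^ a` in the constant.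
    obtain ⟨m, hm1, hm2⟩ := exists_nat_pow_near ((one_le_inv₀ ht).2 ht1) hξ1
    have hlt : volume {x | Y * (ξ ^ a) ^ (m + 1) < ‖f x‖} < ENNReal.ofReal t := by
      rw [hvol]
      refine (hit (m + 1)).trans_lt ?_
      rw [ENNReal.ofReal_lt_ofReal_iff ht]
      exact inv_lt_of_inv_lt₀ ht hm2
    refine (rearr_le_of_volume_lt f t _ (by positivity) hlt).trans (ENNReal.ofReal_le_ofReal ?_)
    have hpow : (ξ ^ a) ^ m ≤ t ^ (-a) := by
      rw [Real.rpow_neg ht.le, ← Real.inv_rpow ht.le, ← Real.rpow_natCast, ← Real.rpow_mul hξ0.le,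
        mul_comm, Real.rpow_mul hξ0.le, Real.rpow_natCast]
      exact Real.rpow_le_rpow (by positivity) hm1 ha0.le
    calc Y * (ξ ^ a) ^ (m + 1) = Y * ξ ^ a * (ξ ^ a) ^ m := by ring
      _ ≤ Y * ξ ^ a * t ^ (-a) := by gcongr
      _ = _ := by rw [hYdef]; ring
  · have ht1' : 1 ≤ t := (not_le.1 ht1).le
    have hlt : volume {x | C₀ * B * t ^ (-b) < ‖f x‖} < ENNReal.ofReal t := by
      refine (hlarge t ht1').trans_lt ?_
      rw [ENNReal.ofReal_lt_ofReal_iff ht]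
      linarith
    refine (rearr_le_of_volume_lt f t _ (by positivity) hlt).trans (ENNReal.ofReal_le_ofReal ?_)
    have hcoef : C₀ * B ≤ (C₀ + C₁) * ξ ^ a * (B + P) := by
      calc C₀ * B ≤ (C₀ + C₁) * 1 * (B + P) := by
            nlinarith [mul_nonneg hC₁ hB.le, mul_nonneg hC₁ hP.le, mul_nonneg hC₀.le hP.le]
        _ ≤ _ := by gcongr
    gcongr
end AnisoBesov

theorem theorem1 {𝕜 : Type*} [RCLike 𝕜] (n : ℕ) (hn : 1 ≤ n)
    (r p : Fin n → ℝ) (θ : Fin n → ℝ≥0∞) (k : Fin n → ℕ)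
    (hr : ∀ j, 0 < r j) (hp : ∀ j, 1 ≤ p j) (hθ : ∀ j, 1 ≤ θ j) (hk : ∀ j, r j < k j)
    (hβ : ∀ j, 0 < beta r p j)
    (p₀ : ℝ) (hp₀ : 0 < p₀) (hp₀' : 1 / p₀ > 1 / meanP r p - meanR r / n)
    (q : ℝ) (hq : max 1 p₀ < q) (hq' : 1 / q > 1 / meanP r p - meanR r / n)
    (s : ℝ) (hs : 0 < s) :
    ∃ c : ℝ≥0, ∀ f : (Fin n → ℝ) → 𝕜,
      MemS0 f → LocallyIntegrable f volume → MemBesov k r p θ f → MemSum p₀ f →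
        MemLorentz f q s ∧
        lorentzNorm f q s ≤ c * (sumNorm p₀ f +
          ∏ j, besovSeminorm j (k j) (r j) (p j) (θ j) f ^ (meanR r / (n * r j))) := by
  have hn0 : (0 : ℝ) < n := by exact_mod_cast hn
  set R := ∑ j, 1 / r j with hR
  set S := ∑ j, 1 / (p j * r j) with hS
  have hR0 : 0 < R :=
    Finset.sum_pos (fun j _ => one_div_pos.2 (hr j)) ⟨⟨0, hn⟩, Finset.mem_univ _⟩
  have hS0 : 0 < S :=
    Finset.sum_pos (fun j _ => one_div_pos.2 (mul_pos (by linarith [hp j]) (hr j)))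
      ⟨⟨0, hn⟩, Finset.mem_univ _⟩
  have hmR : meanR r = n * R⁻¹ := rfl
  -- The critical exponent `1/p - r/n` becomes `(S - 1)/R`, the power of `1/t` in the
  -- self-improvement.
  have hσ : 1 / meanP r p - meanR r / n = (S - 1) / R := by
    rw [meanP, hmR, ← hS]
    field_simp
  have hexp : ∀ j, meanR r / (n * r j) = 1 / (R * r j) := by
    intro j
    have := hr j
    rw [hmR]
    field_simp
  simp_rw [hexp]
  rw [hσ] at hq'
  have hq1 : 1 < q := (le_max_left _ _).trans_lt hq
  have hqp : p₀ < q := (le_max_right _ _).trans_lt hq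
  have hq0 : 0 < q := by linarith
  -- The entry `1/(2q)` keeps `a` positive when `(S - 1)/R ≤ 0`, as `ξ = (2 D ^ n)^{1/a}` requires,
  -- and still lies below `1/q`.
  set a := max ((S - 1) / R) (1 / (2 * q)) with ha
  set b := min 1 (1 / p₀) with hb
  have ha0 : 0 < a := lt_max_of_lt_right (by positivity)
  have haq : a < 1 / q := max_lt hq' (one_div_lt_one_div_of_lt hq0 (by linarith))
  have hbq : 1 / q < b :=
    lt_min (by rw [div_lt_one hq0]; exact hq1) (one_div_lt_one_div_of_lt hp₀ hqp)
  obtain ⟨C, hC, hmain⟩ := exists_rearr_le (𝕜 := 𝕜) hn k r p θ hr hp hθ R S hR hS p₀ hp₀ a b ha0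
    (le_max_left _ _) (min_le_left _ _) (min_le_right _ _)
  set Ψ := (∫⁻ t, (ENNReal.ofReal (t ^ (1 / q)) *
      ENNReal.ofReal (powerMajorant a b t)) ^ s ∂mulMeasure) ^ (1 / s) with hΨ
  have hΨfin : Ψ ≠ ∞ := ENNReal.rpow_ne_top_of_nonneg (by positivity)
    (lintegral_powerMajorant_lt_top a b (1 / q) s haq hbq hs).ne
  refine ⟨C.toNNReal * Ψ.toNNReal, fun f hf _ hB hsum => ?_⟩
  have hbfin : ∀ j, besovSeminorm j (k j) (r j) (p j) (θ j) f ≠ ∞ := fun j =>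
    ((ENNReal.sum_lt_top.1 hB.2) j (Finset.mem_univ j)).ne
  have hsfin : sumNorm p₀ f ≠ ∞ := by
    obtain ⟨g, h, hg, hh, hfgh⟩ := hsum
    refine ne_top_of_le_ne_top (b := eLpNorm g 1 volume + eLpNorm h (ENNReal.ofReal p₀) volume)
      (ENNReal.add_ne_top.2 ⟨hg.2.ne, hh.2.ne⟩) ?_
    exact iInf_le_of_le g (iInf_le_of_le h (iInf_le_of_le hg (iInf_le_of_le hh
      (iInf_le_of_le hfgh le_rfl))))
  set A : Fin n → ℝ := fun j => (besovSeminorm j (k j) (r j) (p j) (θ j) f).toReal with hA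
  set B := (sumNorm p₀ f).toReal with hBdef
  have hA0 : ∀ j, 0 ≤ A j := fun j => ENNReal.toReal_nonneg
  have hB0 : 0 ≤ B := ENNReal.toReal_nonneg
  -- The shift by `ε` covers vanishing seminorms and an infimum in `sumNorm` that need not be
  -- attained. The limit `ε → 0` is harmless because the exponents `1/(R r_j)` are positive and the
  -- constants do not involve `ε`.
  have heps : ∀ ε : ℝ, 0 < ε → lorentzNorm f q s ≤
      ENNReal.ofReal (C * ((B + ε) + ∏ j, (A j + ε) ^ (1 / (R * r j)))) * Ψ := by
    intro ε hε
    have hlt : sumNorm p₀ f < ENNReal.ofReal (B + ε) := by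
      rw [← ENNReal.ofReal_toReal hsfin, ENNReal.ofReal_lt_ofReal_iff (by positivity)]
      linarith
    simp only [sumNorm, iInf_lt_iff] at hlt
    obtain ⟨g, h, hg, hh, hfgh, hlt⟩ := hlt
    have hApos : ∀ j, 0 < A j + ε := fun j => by linarith [hA0 j]
    refine lorentzNorm_le_of_rearr_le f q s a b _ hs ?_
      (hmain f g h (fun j => A j + ε) (B + ε) hf hApos (fun j => ?_)
        hg hh hfgh (by positivity) hlt.le)
    · exact mul_nonneg hC (add_nonneg (by positivity)
        (Finset.prod_nonneg fun j _ => Real.rpow_nonneg (hApos j).le _))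
    · rw [← ENNReal.ofReal_toReal (hbfin j)]
      exact ENNReal.ofReal_le_ofReal (by simp only [hA]; linarith)
  have hlim : lorentzNorm f q s ≤
      ENNReal.ofReal (C * (B + ∏ j, A j ^ (1 / (R * r j)))) * Ψ := by
    have hcont : Continuous fun ε : ℝ =>
        ENNReal.ofReal (C * ((B + ε) + ∏ j, (A j + ε) ^ (1 / (R * r j)))) * Ψ := by
      refine (ENNReal.continuous_mul_const hΨfin).comp (ENNReal.continuous_ofReal.comp ?_)
      refine continuous_const.mul ((continuous_const.add continuous_id).add
        (continuous_finsetProd _ fun j _ => ?_))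
      refine (Real.continuous_rpow_const ?_).comp (continuous_const.add continuous_id)
      have := hr j
      positivity
    have htend := (hcont.tendsto 0).mono_left (nhdsWithin_le_nhds (s := Ioi 0))
    simp only [add_zero] at htend
    refine ge_of_tendsto htend ?_
    filter_upwards [self_mem_nhdsWithin] with ε hε using heps ε hε
  have hprod : ENNReal.ofReal (∏ j, A j ^ (1 / (R * r j))) =
      ∏ j, besovSeminorm j (k j) (r j) (p j) (θ j) f ^ (1 / (R * r j)) := by
    rw [ENNReal.ofReal_prod_of_nonneg fun j _ => Real.rpow_nonneg (hA0 j) _]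
    refine Finset.prod_congr rfl fun j _ => ?_
    have := hr j
    rw [← ENNReal.ofReal_rpow_of_nonneg (hA0 j) (by positivity), ENNReal.ofReal_toReal (hbfin j)]
  have hfinal : lorentzNorm f q s ≤ (C.toNNReal * Ψ.toNNReal : ℝ≥0) * (sumNorm p₀ f +
      ∏ j, besovSeminorm j (k j) (r j) (p j) (θ j) f ^ (1 / (R * r j))) := by
    refine hlim.trans (le_of_eq ?_)
    rw [ENNReal.ofReal_mul hC, ENNReal.ofReal_add hB0
      (Finset.prod_nonneg fun j _ => Real.rpow_nonneg (hA0 j) _), hprod,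
      ENNReal.ofReal_toReal hsfin, ENNReal.coe_mul, ENNReal.coe_toNNReal hΨfin, ENNReal.ofReal]
    ring
  refine ⟨⟨hf, hfinal.trans_lt (ENNReal.mul_lt_top ENNReal.coe_lt_top
    (ENNReal.add_lt_top.2 ⟨hsfin.lt_top, ?_⟩))⟩, hfinal⟩
  rw [← hprod]
  exact ENNReal.ofReal_lt_top
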